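/- Fix a finite set $\sigma$ of relation names, where each $R\in\sigma$ has a finite set $A_R$ of attributes. For a set $A$ of attributes, an $A$-tuple is a map from $A$ to the domain; a $\sigma$-instance $D$ assigns to every $R\in\sigma$ a set $R(D)$ of $A_R$-tuples. Let $Q=\bowtie_{R\in\sigma}R(A_R)$ be the join query with schema $\sigma$: with $A_Q=\bigcup_R A_R$, its answer $Q(D)$ is the set of all $A_Q$-tuples whose restriction to $A_R$ belongs to $R(D)$ for every $R\in\sigma$. A join-project plan is a term built from relation names, binary joins $\bowtie$ and projections $\pi_B$ (each applied to a term whose attribute set contains $B$); a join plan is such a term without projections. Evaluating a plan $\varphi$ in $D$ gives a relation $\varphi(D)$; $\varphi$ is a plan for $Q$ if $\varphi(D)=Q(D)$ for every $\sigma$-instance $D$ over the domain $\mathbb N$. The subplans of a plan are its subterms, including the plan itself. For $N\in\mathbb N$ and $p(N)=(p_R(N))_{R\in\sigma}$, let $\mathcal D(N,p(N))$ be the random $\sigma$-instance with domain $\{1,\dots,N\}$ in which each $A_R$-tuple is placed in $R(D)$ with probability $p_R(N)$, independently for all tuples and all $R\in\sigma$. **Theorem.** Let $\varphi$ be a join-project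 plan for $Q$. There is a constant $c_\varphi$, depending only on $\varphi$ (and $Q$), such that the following holds for all functions $p_R:\mathbb N\to(0,1)$ $(R\in\sigma)$. Let $D_N$ be drawn from $\mathcal D(N,p(N))$. For every sufficiently large $N$ and every real $T$: if $\mathbb E[|\psi(D_N)|]\le T$ for every subplan $\psi$ of $\varphi$, then there is a join plan $\varphi^*_N$ for $Q$ (with no projections) such that $\mathbb E[|\psi(D_N)|]\le c_\varphi T$ for every subplan $\psi$ of $\varphi^*_N$. -/

import Mathlib

/-- An `A`-tuple over the domain `δ`: a map that assigns an element of `δ` to every attribute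
in the finite set `A`. -/
abbrev DBTuple {α : Type*} (A : Finset α) (δ : Type*) := A → δ

/-- A join query `Q = ⋈_{R : ρ} R(A_R)`.  The finite type `ρ` is its schema (its set of relation
names), `α` is the type of all attributes, and `Q.attrs R` is the set `A_R` of attributes
of the relation name `R`. -/
structure JoinQuery (ρ α : Type*) where
  attrs : ρ → Finset α

namespace JoinQuery

variable {ρ α : Type*}

/-- A database instance over the domain `δ`: a set of `A_R`-tuples for every relation name `R`. -/
abbrev Instance (Q : JoinQuery ρ α) (δ : Type*) := ∀ R : ρ, Set (DBTuple (Q.attrs R) δ)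

/-- The set `A_Q` of all attributes of the query. -/
def allAttrs [Fintype ρ] [DecidableEq α] (Q : JoinQuery ρ α) : Finset α :=
  Finset.univ.biUnion Q.attrs

theorem attrs_subset [Fintype ρ] [DecidableEq α] (Q : JoinQuery ρ α) (R : ρ) :
    Q.attrs R ⊆ Q.allAttrs :=
  Finset.subset_biUnion_of_mem Q.attrs (Finset.mem_univ R)

/-- The answer `Q(D)`: the `A_Q`-tuples whose projection to `A_R` is in `R(D)` for every `R`. -/
def answer [Fintype ρ] [DecidableEq α] (Q : JoinQuery ρ α) {δ : Type*} (D : Q.Instance δ) :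
    Set (DBTuple Q.allAttrs δ) :=
  {t | ∀ R : ρ, Finset.restrict₂ (π := fun _ => δ) (Q.attrs_subset R) t ∈ D R}

end JoinQuery

/-- Join-project plans: terms built from relation names, binary joins and projections `π_B`. -/
inductive JPPlan (ρ α : Type*) where
  | rel : ρ → JPPlan ρ α
  | join : JPPlan ρ α → JPPlan ρ α → JPPlan ρ α
  | proj : Finset α → JPPlan ρ α → JPPlan ρ α

namespace JPPlan

variable {ρ α : Type*}

/-- A join plan is a plan without projections. -/
def IsJoinPlan : JPPlan ρ α → Prop
  | rel _ => True
  | join φ ψ => φ.IsJoinPlan ∧ ψ.IsJoinPlan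
  | proj _ _ => False

/-- The subplans of a plan (the plan itself is one of them). -/
def subplans : JPPlan ρ α → Set (JPPlan ρ α)
  | rel R => {rel R}
  | join φ ψ => {join φ ψ} ∪ (φ.subplans ∪ ψ.subplans)
  | proj B φ => {proj B φ} ∪ φ.subplans

variable [DecidableEq α]

/-- The set `A_φ` of (free) attributes of the relation computed by `φ`. -/
def attrs (Q : JoinQuery ρ α) : JPPlan ρ α → Finset α
  | rel R => Q.attrs R
  | join φ ψ => φ.attrs Q ∪ ψ.attrs Q
  | proj B _ => B

/-- Every projection `π_B` in the plan is applied to a relation that has all attributes in `B`. -/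
def WellFormed (Q : JoinQuery ρ α) : JPPlan ρ α → Prop
  | rel _ => True
  | join φ ψ => φ.WellFormed Q ∧ ψ.WellFormed Q
  | proj B φ => B ⊆ φ.attrs Q ∧ φ.WellFormed Q

/-- The relation `φ(D)` obtained by evaluating the plan `φ` in the instance `D`.  In the last
clause, `t` is the restriction of `s` to `B` (for a well-formed plan). -/
def eval (Q : JoinQuery ρ α) {δ : Type*} (D : Q.Instance δ) :
    (φ : JPPlan ρ α) → Set (DBTuple (φ.attrs Q) δ)
  | rel R => D R
  | join φ ψ =>
    {t : DBTuple (φ.attrs Q ∪ ψ.attrs Q) δ |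
      Finset.restrict₂ (π := fun _ => δ) Finset.subset_union_left t ∈ φ.eval Q D ∧
      Finset.restrict₂ (π := fun _ => δ) Finset.subset_union_right t ∈ ψ.eval Q D}
  | proj B φ =>
    {t : DBTuple B δ | ∃ s ∈ φ.eval Q D,
      ∀ (a : α) (hB : a ∈ B) (hA : a ∈ φ.attrs Q), t ⟨a, hB⟩ = s ⟨a, hA⟩}

/-- `φ` is a plan for `Q`: it is a well-formed term, and `φ(D) = Q(D)` for every database `D`
(over the countably infinite domain `ℕ`).  Since `A_φ = A_Q`, the map `restrict₂` below only
identifies `A_Q`-tuples with `A_φ`-tuples. -/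
def IsPlanFor [Fintype ρ] (Q : JoinQuery ρ α) (φ : JPPlan ρ α) : Prop :=
  φ.WellFormed Q ∧ ∃ h : φ.attrs Q = Q.allAttrs, ∀ D : Q.Instance ℕ,
    ∀ t : DBTuple Q.allAttrs ℕ,
      Finset.restrict₂ (π := fun _ => ℕ) h.subset t ∈ φ.eval Q D ↔ t ∈ Q.answer D

end JPPlan

namespace JoinQuery

variable {ρ α : Type*} [Fintype ρ]

open scoped Classical in
/-- The probability of the instance `D` in the random database model with an `N`-element domain:
every tuple is placed in `R(D)` with probability `p R`, independently for all tuples and all `R`. -/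
noncomputable def instanceProb (Q : JoinQuery ρ α) (N : ℕ) (p : ρ → ℝ)
    (D : Q.Instance (Fin N)) : ℝ :=
  ∏ R : ρ, ∏ t : DBTuple (Q.attrs R) (Fin N), if t ∈ D R then p R else 1 - p R

open scoped Classical in
/-- The expected size `E[|φ(D)|]` of the result of the plan `φ` on a random database `D`. -/
noncomputable def expectedSize [DecidableEq α] (Q : JoinQuery ρ α) (N : ℕ) (p : ρ → ℝ)
    (φ : JPPlan ρ α) : ℝ :=
  ∑ D : Q.Instance (Fin N), Q.instanceProb N p D * ((φ.eval Q D).ncard : ℝ)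

end JoinQuery

/-! Every subplan φ gets a set W of relation names with two properties. `Likely`: once the atoms
that W requires of an assignment are planted, φ accepts the assignment with probability bounded
below independently of N and p. `Tight`: among attribute sets containing those of φ, adding all
attributes of W gives the least `weight`. A second moment argument then bounds E|φ(D)| below by a
constant times the weight of W, which is the expected size of a join over W
(`weight_le_expectedSize`). So joining W instead of evaluating φ is affordable.

At a join the two sets are united: Harris' inequality preserves `Likely`, submodularity of the
weight preserves `Tight` (`Likely.join`, `Tight.union`). At a projection to B, take a
weight-minimizing C containing B and discard the names not contained in C. By minimality no partial
extension beyond C has expected number below 1, so the discarded names can be satisfied with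
constant probability (`Likely.extend`), and pruning them from the join plan built so far enlarges no
intermediate result (`weight_filter_le`).

A name with an occurrence whose attributes are all kept is never discarded. In a plan for Q every
name has one (`IsPlanFor.survivors_eq_univ`), so at the root W is the whole schema and the join plan
computes Q. -/

section RandomSubset

/-! ### Independent random subsets: planting, Harris' inequality, second moments -/

variable {ι : Type*} [Fintype ι] [DecidableEq ι]

/-- The probability of the outcome `F` when every `i` is selected independently with
probability `q i`. -/
def subsetWeight (q : ι → ℝ) (F : Finset ι) : ℝ := ∏ i, if i ∈ F then q i else 1 - q i

/-- The expectation of `f F` for a random subset `F`. -/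
def subsetExp (q : ι → ℝ) (f : Finset ι → ℝ) : ℝ := ∑ F, subsetWeight q F * f F

open scoped Classical in
/-- The probability that a random subset has the property `P`. -/
noncomputable def subsetProb (q : ι → ℝ) (P : Finset ι → Prop) : ℝ :=
  subsetExp q fun F => if P F then 1 else 0

variable {q : ι → ℝ}

theorem subsetWeight_nonneg (hq : ∀ i, q i ∈ Set.Ioo (0 : ℝ) 1) (F : Finset ι) :
    0 ≤ subsetWeight q F :=
  Finset.prod_nonneg fun i _ => by
    split_ifs
    · exact (hq i).1.le
    · linarith [(hq i).2]

theorem sum_subsetWeight (q : ι → ℝ) : ∑ F, subsetWeight q F = 1 := by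
  have h := Finset.prod_add q (fun i => 1 - q i) Finset.univ
  simp only [add_sub_cancel, Finset.prod_const_one, Finset.powerset_univ] at h
  rw [h]
  refine Finset.sum_congr rfl fun F _ => ?_
  rw [subsetWeight, Finset.prod_ite]
  congr 2
  · ext i; simp
  · ext i; simp

theorem subsetExp_const (q : ι → ℝ) (c : ℝ) : subsetExp q (fun _ => c) = c := by
  rw [subsetExp, ← Finset.sum_mul, sum_subsetWeight, one_mul]

theorem subsetExp_mono (hq : ∀ i, q i ∈ Set.Ioo (0 : ℝ) 1) {f g : Finset ι → ℝ}
    (h : ∀ F, f F ≤ g F) : subsetExp q f ≤ subsetExp q g :=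
  Finset.sum_le_sum fun F _ => mul_le_mul_of_nonneg_left (h F) (subsetWeight_nonneg hq F)

theorem subsetExp_sum {κ : Type*} (s : Finset κ) (f : κ → Finset ι → ℝ) :
    subsetExp q (fun F => ∑ k ∈ s, f k F) = ∑ k ∈ s, subsetExp q (f k) := by
  simp only [subsetExp, Finset.mul_sum]
  exact Finset.sum_comm

theorem subsetProb_mono (hq : ∀ i, q i ∈ Set.Ioo (0 : ℝ) 1) {P P' : Finset ι → Prop}
    (h : ∀ F, P F → P' F) : subsetProb q P ≤ subsetProb q P' :=
  subsetExp_mono hq fun F => by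
    by_cases h1 : P F
    · simp [h1, h F h1]
    · simp only [h1, if_false]; split_ifs <;> norm_num

theorem subsetProb_nonneg (hq : ∀ i, q i ∈ Set.Ioo (0 : ℝ) 1) (P : Finset ι → Prop) :
    0 ≤ subsetProb q P :=
  Finset.sum_nonneg fun F _ => mul_nonneg (subsetWeight_nonneg hq F) (by
    dsimp only; split_ifs <;> norm_num)

theorem subsetProb_of_forall {P : Finset ι → Prop} (h : ∀ F, P F) : subsetProb q P = 1 := by
  simp [subsetProb, h, subsetExp_const]

theorem subsetWeight_insert (q : ι → ℝ) {z : ι} {F : Finset ι} (hz : z ∉ F) :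
    subsetWeight q (insert z F) * (1 - q z) = q z * subsetWeight q F := by
  have key : ∀ G : Finset ι, subsetWeight q G = (if z ∈ G then q z else 1 - q z) *
      ∏ i ∈ Finset.univ.erase z, if i ∈ G then q i else 1 - q i := fun G =>
    (Finset.mul_prod_erase _ _ (Finset.mem_univ z)).symm
  rw [key, key F]
  have : (∏ i ∈ Finset.univ.erase z, if i ∈ insert z F then q i else 1 - q i) =
      ∏ i ∈ Finset.univ.erase z, if i ∈ F then q i else 1 - q i :=
    Finset.prod_congr rfl fun i hi => by simp [Finset.ne_of_mem_erase hi]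
  rw [this]
  simp [hz]
  ring

/-- Conditioning a random subset on containing `z` amounts to adding `z`. -/
theorem subsetExp_insert (q : ι → ℝ) (z : ι) (g : Finset ι → ℝ) :
    subsetExp q (fun F => if z ∈ F then g F else 0) =
      q z * subsetExp q (fun F => g (insert z F)) := by
  -- Toggling `z` matches the sets without `z` to those with it; the two halves add up with
  -- coefficients `1 - q z` and `q z`.
  have hbij : ∑ F with z ∉ F, q z * (subsetWeight q F * g (insert z F)) =
      ∑ F with z ∈ F, (1 - q z) * (subsetWeight q F * g F) := by
    refine Finset.sum_nbij' (insert z) (fun F => F.erase z) ?_ ?_ ?_ ?_ ?_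
    · simp
    · simp
    · intro F hF; simp at hF; exact Finset.erase_insert hF
    · intro F hF; simp at hF; exact Finset.insert_erase hF
    · intro F hF
      simp at hF
      rw [← mul_assoc, ← subsetWeight_insert q hF]
      ring
  have hins : ∑ F with z ∈ F, q z * (subsetWeight q F * g (insert z F)) =
      ∑ F with z ∈ F, q z * (subsetWeight q F * g F) :=
    Finset.sum_congr rfl fun F hF => by
      simp at hF; rw [Finset.insert_eq_of_mem hF]
  simp only [subsetExp, Finset.mul_sum, mul_ite, mul_zero]
  rw [← Finset.sum_filter, ← Finset.sum_filter_add_sum_filter_not Finset.univ (fun F => z ∈ F)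
    (fun F => q z * (subsetWeight q F * g (insert z F))), hbij, hins, ← Finset.sum_add_distrib]
  exact Finset.sum_congr rfl fun F _ => by ring

/-- Conditioning a random subset on containing `Z` amounts to adding `Z`. -/
theorem subsetExp_union (q : ι → ℝ) (Z : Finset ι) (g : Finset ι → ℝ) :
    subsetExp q (fun F => if Z ⊆ F then g F else 0) =
      (∏ z ∈ Z, q z) * subsetExp q (fun F => g (F ∪ Z)) := by
  induction Z using Finset.induction_on generalizing g with
  | empty => simp
  | insert z Z hz ih =>
    have h1 : (fun F : Finset ι => if insert z Z ⊆ F then g F else 0) =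
        fun F => if z ∈ F then (if Z ⊆ F then g F else 0) else 0 := by
      funext F
      by_cases h : z ∈ F <;> simp [Finset.insert_subset_iff, h]
    have h2 : (fun F : Finset ι => if Z ⊆ insert z F then g (insert z F) else 0) =
        fun F => if Z ⊆ F then g (insert z F) else 0 := by
      funext F
      simp only [Finset.subset_insert_iff_of_notMem hz]
    rw [h1, subsetExp_insert, h2, ih (fun F => g (insert z F)), Finset.prod_insert hz, mul_assoc]
    simp [Finset.union_insert]

theorem subsetProb_subset (q : ι → ℝ) (Z : Finset ι) :
    subsetProb q (fun F => Z ⊆ F) = ∏ z ∈ Z, q z := by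
  have h := subsetExp_union q Z (fun _ => 1)
  rw [subsetExp_const, mul_one] at h
  rw [← h, subsetProb]
  congr 1
  funext F
  congr

theorem subsetProb_union (q : ι → ℝ) (Z : Finset ι) (P : Finset ι → Prop) :
    subsetProb q (fun F => Z ⊆ F ∧ P F) = (∏ z ∈ Z, q z) * subsetProb q (fun F => P (F ∪ Z)) := by
  classical
  rw [subsetProb, subsetProb, ← subsetExp_union q Z (fun F => if P F then 1 else 0)]
  congr 1
  funext F
  by_cases h : Z ⊆ F <;> simp [h]

/-- Harris' inequality. -/
theorem subsetProb_mul_le (hq : ∀ i, q i ∈ Set.Ioo (0 : ℝ) 1) {P P' : Finset ι → Prop}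
    (hP : Monotone P) (hP' : Monotone P') :
    subsetProb q P * subsetProb q P' ≤ subsetProb q (fun F => P F ∧ P' F) := by
  classical
  have hmono : ∀ {R : Finset ι → Prop}, Monotone R →
      Monotone (fun F => if R F then (1 : ℝ) else 0) := by
    intro R hR F G hFG
    by_cases h : R F
    · simp [h, hR hFG h]
    · simp only [h, if_false]; split_ifs <;> norm_num
  -- For a product measure the FKG lattice condition holds with equality, coordinate by coordinate.
  have h := fkg (μ := subsetWeight q) (f := fun F => if P F then (1 : ℝ) else 0)
    (g := fun F => if P' F then (1 : ℝ) else 0) (subsetWeight_nonneg hq)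
    (fun F => by dsimp; split_ifs <;> norm_num) (fun F => by dsimp; split_ifs <;> norm_num)
    (hmono hP) (hmono hP') (fun F G => by
      rw [subsetWeight, subsetWeight, subsetWeight, subsetWeight, ← Finset.prod_mul_distrib,
        ← Finset.prod_mul_distrib]
      refine (Finset.prod_congr rfl fun i _ => ?_).le
      by_cases h1 : i ∈ F <;> by_cases h2 : i ∈ G <;> simp [h1, h2, mul_comm])
  rw [sum_subsetWeight, one_mul] at h
  refine h.trans_eq (Finset.sum_congr rfl fun F _ => ?_)
  by_cases h1 : P F <;> by_cases h2 : P' F <;> simp [h1, h2]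

/-- The second moment method. -/
theorem subsetExp_sq_le (hq : ∀ i, q i ∈ Set.Ioo (0 : ℝ) 1) (f : Finset ι → ℝ) :
    subsetExp q f ^ 2 ≤ subsetExp q (fun F => f F ^ 2) * subsetProb q (fun F => f F ≠ 0) := by
  classical
  -- Cauchy–Schwarz for `f` times the indicator of `f ≠ 0`.
  refine Finset.sum_sq_le_sum_mul_sum_of_sq_le_mul _
    (fun F _ => mul_nonneg (subsetWeight_nonneg hq F) (sq_nonneg _))
    (fun F _ => mul_nonneg (subsetWeight_nonneg hq F) (by dsimp; split_ifs <;> norm_num)) fun F _ => le_of_eq ?_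
  by_cases h : f F = 0
  · simp [h]
  · simp [h]; ring

end RandomSubset

/-! ### Weights of attribute sets, submodularity and tightness -/

namespace JoinQuery

variable {ρ α : Type*} [DecidableEq α]

/-- All attributes of the relation names in `W`. -/
def attrsOf (Q : JoinQuery ρ α) (W : Finset ρ) : Finset α := W.biUnion Q.attrs

/-- The expected number of assignments of the attributes in `C` that satisfy all relation
names in `W` whose attributes are contained in `C`. -/
def weight (Q : JoinQuery ρ α) (N : ℕ) (p : ρ → ℝ) (W : Finset ρ) (C : Finset α) : ℝ :=
  (N : ℝ) ^ C.card * ∏ R ∈ W with Q.attrs R ⊆ C, p R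

/-- An assignment of `B` has, in expectation, the fewest extensions when all attributes of `W`
are assigned. -/
def Tight (Q : JoinQuery ρ α) (N : ℕ) (p : ρ → ℝ) (W : Finset ρ) (B : Finset α) : Prop :=
  ∀ C, B ⊆ C → Q.weight N p W (B ∪ Q.attrsOf W) ≤ Q.weight N p W C

variable {Q : JoinQuery ρ α} {N : ℕ} {p : ρ → ℝ}

theorem attrs_subset_attrsOf {W : Finset ρ} {R : ρ} (h : R ∈ W) : Q.attrs R ⊆ Q.attrsOf W :=
  Finset.subset_biUnion_of_mem Q.attrs h

theorem attrsOf_mono {W W' : Finset ρ} (h : W' ⊆ W) : Q.attrsOf W' ⊆ Q.attrsOf W :=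
  Finset.biUnion_subset_biUnion_of_subset_left _ h

theorem weight_pos (hN : 0 < N) (hp : ∀ R, p R ∈ Set.Ioo (0 : ℝ) 1) (W : Finset ρ)
    (C : Finset α) : 0 < Q.weight N p W C :=
  mul_pos (pow_pos (by exact_mod_cast hN) _) (Finset.prod_pos fun R _ => (hp R).1)

/-- Attributes that do not complete a relation name only increase the weight. -/
theorem weight_le_of_filter_eq (hN : 0 < N) (hp : ∀ R, p R ∈ Set.Ioo (0 : ℝ) 1) {W W' : Finset ρ}
    {C C' : Finset α} (hC : C' ⊆ C)
    (h : {R ∈ W' | Q.attrs R ⊆ C'} = {R ∈ W | Q.attrs R ⊆ C}) :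
    Q.weight N p W' C' ≤ Q.weight N p W C := by
  rw [weight, weight, h]
  refine mul_le_mul_of_nonneg_right ?_ (Finset.prod_nonneg fun R _ => (hp R).1.le)
  exact pow_le_pow_right₀ (by exact_mod_cast hN) (Finset.card_le_card hC)

/-- The powers of `N` agree on both sides, and each name contributes its factor `p R < 1` at least
as often on the left. Allowing a smaller `W'` lets tightness for part of the names act on all of
`W`. -/
theorem weight_submodular (hp : ∀ R, p R ∈ Set.Ioo (0 : ℝ) 1) {W W' : Finset ρ} (hW : W' ⊆ W)
    (C C' : Finset α) :
    Q.weight N p W (C ∪ C') * Q.weight N p W' (C ∩ C') ≤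
      Q.weight N p W C * Q.weight N p W' C' := by
  have key : (∏ R ∈ W with Q.attrs R ⊆ C ∪ C', p R) * (∏ R ∈ W' with Q.attrs R ⊆ C ∩ C', p R) ≤
      (∏ R ∈ W with Q.attrs R ⊆ C, p R) * ∏ R ∈ W' with Q.attrs R ⊆ C', p R := by
    classical
    have hW' : ∀ D : Finset α, ∏ R ∈ W' with Q.attrs R ⊆ D, p R =
        ∏ R ∈ W, if R ∈ W' ∧ Q.attrs R ⊆ D then p R else 1 := fun D => by
      rw [← Finset.prod_filter]
      congr 1
      ext R
      simp only [Finset.mem_filter]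
      exact ⟨fun h => ⟨hW h.1, h⟩, fun h => h.2⟩
    rw [hW', hW', Finset.prod_filter, Finset.prod_filter, ← Finset.prod_mul_distrib,
      ← Finset.prod_mul_distrib]
    refine Finset.prod_le_prod (fun R _ => ?_) fun R _ => ?_
    · have := (hp R).1
      split_ifs <;> positivity
    · have h0 := (hp R).1
      have h1 := (hp R).2
      by_cases hR : R ∈ W' <;> by_cases hC : Q.attrs R ⊆ C <;> by_cases hC' : Q.attrs R ⊆ C' <;>
        by_cases hU : Q.attrs R ⊆ C ∪ C' <;> simp [hR, hC, hC', hU, Finset.subset_inter_iff] <;>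
        first
          | exact h1.le
          | exact absurd (hC.trans Finset.subset_union_left) hU
          | exact absurd (hC'.trans Finset.subset_union_right) hU
  have hcard : (N : ℝ) ^ (C ∪ C').card * (N : ℝ) ^ (C ∩ C').card =
      (N : ℝ) ^ C.card * (N : ℝ) ^ C'.card := by
    rw [← pow_add, ← pow_add, Finset.card_union_add_card_inter]
  calc _ = ((N : ℝ) ^ (C ∪ C').card * (N : ℝ) ^ (C ∩ C').card) *
        ((∏ R ∈ W with Q.attrs R ⊆ C ∪ C', p R) *
          (∏ R ∈ W' with Q.attrs R ⊆ C ∩ C', p R)) := by simp only [weight]; ring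
    _ ≤ ((N : ℝ) ^ C.card * (N : ℝ) ^ C'.card) *
        ((∏ R ∈ W with Q.attrs R ⊆ C, p R) * ∏ R ∈ W' with Q.attrs R ⊆ C', p R) := by
        rw [hcard]; exact mul_le_mul_of_nonneg_left key (by positivity)
    _ = _ := by simp only [weight]; ring

/-- Diminishing returns: enlarging `C ∩ C'` to `C'` costs nothing for `W'`, so by submodularity the
same new attributes cost nothing on top of `C` for `W`. -/
theorem weight_union_le (hN : 0 < N) (hp : ∀ R, p R ∈ Set.Ioo (0 : ℝ) 1) {W W' : Finset ρ}
    (hW : W' ⊆ W) {C C' : Finset α}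
    (h : Q.weight N p W' C' ≤ Q.weight N p W' (C ∩ C')) :
    Q.weight N p W (C ∪ C') ≤ Q.weight N p W C := by
  have h1 := weight_submodular (Q := Q) (N := N) hp hW C C'
  have h2 := weight_pos (Q := Q) hN hp W' C'
  have h3 := weight_pos (Q := Q) hN hp W (C ∪ C')
  refine le_of_mul_le_mul_right (a := Q.weight N p W' C') ?_ h2
  exact (mul_le_mul_of_nonneg_left h h3.le).trans h1

theorem tight_singleton (hN : 0 < N) (hp : ∀ R, p R ∈ Set.Ioo (0 : ℝ) 1) (R : ρ) :
    Q.Tight N p {R} (Q.attrs R) := by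
  intro C hC
  have h : Q.attrs R ∪ Q.attrsOf {R} = Q.attrs R := by simp [attrsOf]
  rw [h]
  exact weight_le_of_filter_eq hN hp hC (by simp [Finset.filter_singleton, hC])

/-- `C` absorbs the two tight sets one after the other without gaining weight. All names are then
complete, so the superfluous attributes of `C` can be shed. -/
theorem Tight.union [DecidableEq ρ] (hN : 0 < N) (hp : ∀ R, p R ∈ Set.Ioo (0 : ℝ) 1)
    {W₁ W₂ : Finset ρ} {B₁ B₂ : Finset α} (h₁ : Q.Tight N p W₁ B₁) (h₂ : Q.Tight N p W₂ B₂) :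
    Q.Tight N p (W₁ ∪ W₂) (B₁ ∪ B₂) := by
  intro C hC
  have hB₁ := Finset.subset_union_left.trans hC
  have hB₂ := Finset.subset_union_right.trans hC
  have s1 : Q.weight N p (W₁ ∪ W₂) (C ∪ (B₁ ∪ Q.attrsOf W₁)) ≤ Q.weight N p (W₁ ∪ W₂) C :=
    weight_union_le hN hp Finset.subset_union_left
      (h₁ _ (Finset.subset_inter hB₁ Finset.subset_union_left))
  have s2 : Q.weight N p (W₁ ∪ W₂) (C ∪ (B₁ ∪ Q.attrsOf W₁) ∪ (B₂ ∪ Q.attrsOf W₂)) ≤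
      Q.weight N p (W₁ ∪ W₂) (C ∪ (B₁ ∪ Q.attrsOf W₁)) :=
    weight_union_le hN hp Finset.subset_union_right
      (h₂ _ (Finset.subset_inter (hB₂.trans Finset.subset_union_left) Finset.subset_union_left))
  refine le_trans ?_ (s2.trans s1)
  have hW : Q.attrsOf (W₁ ∪ W₂) = Q.attrsOf W₁ ∪ Q.attrsOf W₂ := Finset.union_biUnion
  have hsub : B₁ ∪ B₂ ∪ Q.attrsOf (W₁ ∪ W₂) ⊆
      C ∪ (B₁ ∪ Q.attrsOf W₁) ∪ (B₂ ∪ Q.attrsOf W₂) := by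
    rw [hW]
    intro a
    simp only [Finset.mem_union]
    tauto
  refine weight_le_of_filter_eq hN hp hsub (Finset.filter_congr fun R hR => ?_)
  have hR' := (attrs_subset_attrsOf (Q := Q) hR).trans
    (Finset.subset_union_right (s₁ := B₁ ∪ B₂))
  exact ⟨fun h => h.trans hsub, fun _ => hR'⟩

theorem exists_weight_minimizer (hN : 0 < N) (hp : ∀ R, p R ∈ Set.Ioo (0 : ℝ) 1) (W : Finset ρ)
    (B : Finset α) : ∃ C, B ⊆ C ∧ ∀ C', B ⊆ C' → Q.weight N p W C ≤ Q.weight N p W C' := by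
  -- The attribute type may be infinite, but attributes outside `B` and `W` complete no name and can
  -- be intersected away.
  obtain ⟨C, hC, hmin⟩ := Finset.exists_min_image
    ((B ∪ Q.attrsOf W).powerset.filter (B ⊆ ·)) (Q.weight N p W) 
    ⟨B, Finset.mem_filter.2 ⟨Finset.mem_powerset.2 Finset.subset_union_left, subset_rfl⟩⟩
  simp only [Finset.mem_filter, Finset.mem_powerset] at hC hmin
  refine ⟨C, hC.2, fun C' hC' => ?_⟩
  refine (hmin (C' ∩ (B ∪ Q.attrsOf W)) ⟨Finset.inter_subset_right,
    Finset.subset_inter hC' Finset.subset_union_left⟩).trans ?_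
  refine weight_le_of_filter_eq hN hp Finset.inter_subset_left
    (Finset.filter_congr fun R hR => ?_)
  rw [Finset.subset_inter_iff]
  exact and_iff_left ((attrs_subset_attrsOf hR).trans Finset.subset_union_right)

theorem attrsOf_filter_subset (W : Finset ρ) (C : Finset α) :
    Q.attrsOf {R ∈ W | Q.attrs R ⊆ C} ⊆ C :=
  Finset.biUnion_subset.2 fun _ hR => (Finset.mem_filter.1 hR).2

/-- Once the names outside `C` are gone, only `C' ∩ C` matters in a competitor `C'`, and there
minimality of `C` applies. -/
theorem tight_of_minimizer (hN : 0 < N) (hp : ∀ R, p R ∈ Set.Ioo (0 : ℝ) 1) {W : Finset ρ}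
    {B C : Finset α} (hB : B ⊆ C)
    (hmin : ∀ C', B ⊆ C' → Q.weight N p W C ≤ Q.weight N p W C') :
    Q.Tight N p {R ∈ W | Q.attrs R ⊆ C} B := by
  intro C' hC'
  calc _ ≤ Q.weight N p W C := by
        refine weight_le_of_filter_eq hN hp
          (Finset.union_subset hB (attrsOf_filter_subset W C)) ?_
        exact Finset.filter_true_of_mem fun R hR =>
          (attrs_subset_attrsOf hR).trans Finset.subset_union_right
    _ ≤ Q.weight N p W (C' ∩ C) := hmin _ (Finset.subset_inter hC' hB)
    _ ≤ _ := by
        refine weight_le_of_filter_eq hN hp Finset.inter_subset_left ?_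
        rw [Finset.filter_filter]
        exact Finset.filter_congr fun R _ => by rw [Finset.subset_inter_iff, and_comm]

/-- Dropping the relation names that are not contained in a weight-minimizing set of attributes
does not increase the expected size of a join. -/
theorem weight_filter_le (hN : 0 < N) (hp : ∀ R, p R ∈ Set.Ioo (0 : ℝ) 1) {W W' : Finset ρ}
    (hW : W' ⊆ W) {B C : Finset α} (hB : B ⊆ C)
    (hmin : ∀ C', B ⊆ C' → Q.weight N p W C ≤ Q.weight N p W C') :
    Q.weight N p {R ∈ W' | Q.attrs R ⊆ C} (Q.attrsOf {R ∈ W' | Q.attrs R ⊆ C}) ≤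
      Q.weight N p W' (Q.attrsOf W') := by
  have h1 := weight_submodular (Q := Q) (N := N) hp hW C (Q.attrsOf W')
  have h2 := hmin (C ∪ Q.attrsOf W') (hB.trans Finset.subset_union_left)
  have h3 := weight_pos (Q := Q) hN hp W C
  have h4 := weight_pos (Q := Q) hN hp W' (C ∩ Q.attrsOf W')
  -- By minimality the union with `C` is no lighter than `C`, so submodularity forces the
  -- intersection to be no heavier than `Q.attrsOf W'`.
  have h5 : Q.weight N p W' (C ∩ Q.attrsOf W') ≤ Q.weight N p W' (Q.attrsOf W') :=
    le_of_mul_le_mul_left ((mul_le_mul_of_nonneg_right h2 h4.le).trans h1) h3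
  refine le_trans ?_ h5
  refine weight_le_of_filter_eq hN hp (Finset.subset_inter (attrsOf_filter_subset W' C)
    (attrsOf_mono (Finset.filter_subset _ _))) ?_
  rw [Finset.filter_true_of_mem fun R hR => attrs_subset_attrsOf hR]
  exact Finset.filter_congr fun R hR => by
    rw [Finset.subset_inter_iff]
    exact (and_iff_left (attrs_subset_attrsOf hR)).symm

end JoinQuery

/-! ### Syntax of plans: pruning, surviving names, correctness of join plans -/

namespace JPPlan

variable {ρ α : Type*}

theorem mem_subplans_self (φ : JPPlan ρ α) : φ ∈ φ.subplans := by
  cases φ <;> simp [subplans]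

theorem IsJoinPlan.of_mem_subplans {θ ξ : JPPlan ρ α} (hθ : θ.IsJoinPlan)
    (hξ : ξ ∈ θ.subplans) : ξ.IsJoinPlan := by
  induction θ with
  | rel R => rw [Set.mem_singleton_iff.1 hξ]; trivial
  | join φ ψ ihφ ihψ =>
    rcases hξ with h | h | h
    · rw [Set.mem_singleton_iff.1 h]; exact hθ
    · exact ihφ hθ.1 h
    · exact ihψ hθ.2 h
  | proj B φ _ => exact hθ.elim

section Relations

variable [DecidableEq ρ]

/-- The relation names that occur in a plan. -/
def rels : JPPlan ρ α → Finset ρ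
  | rel R => {R}
  | join φ ψ => φ.rels ∪ ψ.rels
  | proj _ φ => φ.rels

theorem rels_subset_of_mem_subplans {φ ψ : JPPlan ρ α} (h : ψ ∈ φ.subplans) :
    ψ.rels ⊆ φ.rels := by
  induction φ with
  | rel R => rw [Set.mem_singleton_iff.1 h]
  | join φ₁ φ₂ ih₁ ih₂ =>
    rcases h with h | h | h
    · rw [Set.mem_singleton_iff.1 h]
    · exact (ih₁ h).trans Finset.subset_union_left
    · exact (ih₂ h).trans Finset.subset_union_right
  | proj B φ ih =>
    rcases h with h | h
    · rw [Set.mem_singleton_iff.1 h]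
    · exact ih h

theorem rels_nonempty (φ : JPPlan ρ α) : φ.rels.Nonempty := by
  induction φ with
  | rel R => exact Finset.singleton_nonempty R
  | join φ ψ ihφ _ => exact ihφ.mono Finset.subset_union_left
  | proj B φ ih => exact ih

/-- A join plan can be restricted to the relation names with a given property. -/
theorem exists_restrict (P : ρ → Prop) [DecidablePred P] (θ : JPPlan ρ α) (hθ : θ.IsJoinPlan) :
    θ.rels.filter P = ∅ ∨ ∃ θ' : JPPlan ρ α, θ'.IsJoinPlan ∧ θ'.rels = θ.rels.filter P ∧
      ∀ ξ' ∈ θ'.subplans, ∃ ξ ∈ θ.subplans, ξ'.rels = ξ.rels.filter P := by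
  induction θ with
  | rel R =>
    by_cases h : P R
    · exact Or.inr ⟨rel R, hθ, by simp [rels, Finset.filter_singleton, h], fun ξ' hξ' =>
        ⟨rel R, rfl, by
          rw [Set.mem_singleton_iff.1 hξ']; simp [rels, Finset.filter_singleton, h]⟩⟩
    · exact Or.inl (by simp [rels, Finset.filter_singleton, h])
  | join φ ψ ihφ ihψ =>
    have hu : (join φ ψ).rels.filter P = φ.rels.filter P ∪ ψ.rels.filter P :=
      Finset.filter_union _ _ _
    rcases ihφ hθ.1 with h₁ | ⟨θ₁, hj₁, hr₁, hs₁⟩ <;> rcases ihψ hθ.2 with h₂ | ⟨θ₂, hj₂, hr₂, hs₂⟩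
    · exact Or.inl (by rw [hu, h₁, h₂, Finset.union_empty])
    · refine Or.inr ⟨θ₂, hj₂, by rw [hr₂, hu, h₁, Finset.empty_union], fun ξ' hξ' => ?_⟩
      obtain ⟨ξ, hξ, h⟩ := hs₂ ξ' hξ'
      exact ⟨ξ, Or.inr (Or.inr hξ), h⟩
    · refine Or.inr ⟨θ₁, hj₁, by rw [hr₁, hu, h₂, Finset.union_empty], fun ξ' hξ' => ?_⟩
      obtain ⟨ξ, hξ, h⟩ := hs₁ ξ' hξ'
      exact ⟨ξ, Or.inr (Or.inl hξ), h⟩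
    · have hr : (join θ₁ θ₂).rels = (join φ ψ).rels.filter P := by rw [hu, ← hr₁, ← hr₂]; rfl
      refine Or.inr ⟨join θ₁ θ₂, ⟨hj₁, hj₂⟩, hr, fun ξ' hξ' => ?_⟩
      rcases hξ' with h | h | h
      · exact ⟨join φ ψ, Or.inl rfl, by rw [Set.mem_singleton_iff.1 h, hr]⟩
      · obtain ⟨ξ, hξ, h⟩ := hs₁ ξ' h
        exact ⟨ξ, Or.inr (Or.inl hξ), h⟩
      · obtain ⟨ξ, hξ, h⟩ := hs₂ ξ' h
        exact ⟨ξ, Or.inr (Or.inr hξ), h⟩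
  | proj B φ _ => exact hθ.elim

variable [DecidableEq α]

/-- The relation names with an occurrence none of whose attributes is projected away. -/
def survivors (Q : JoinQuery ρ α) : JPPlan ρ α → Finset ρ
  | rel R => {R}
  | join φ ψ => φ.survivors Q ∪ ψ.survivors Q
  | proj B φ => {R ∈ φ.survivors Q | Q.attrs R ⊆ B}

variable {Q : JoinQuery ρ α}

theorem attrs_eq_attrsOf_rels (θ : JPPlan ρ α) (hθ : θ.IsJoinPlan) :
    θ.attrs Q = Q.attrsOf θ.rels := by
  induction θ with
  | rel R => simp [attrs, rels, JoinQuery.attrsOf]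
  | join φ ψ ihφ ihψ =>
    rw [attrs, ihφ hθ.1, ihψ hθ.2, rels]
    exact Finset.union_biUnion.symm
  | proj B φ _ => exact hθ.elim

/-- The instance that lacks exactly the all-zero tuple of `R`. -/
def punctured (Q : JoinQuery ρ α) (R : ρ) : Q.Instance ℕ :=
  fun R' => {t | R' = R → ∃ a, t a ≠ 0}

theorem mem_eval_punctured {R : ρ} (φ : JPPlan ρ α) (s : α → ℕ)
    (h : R ∈ φ.survivors Q → ∃ a ∈ Q.attrs R, s a ≠ 0) :
    (fun a => s a : DBTuple (φ.attrs Q) ℕ) ∈ φ.eval Q (punctured Q R) := by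
  induction φ generalizing s with
  | rel R' =>
    intro hR
    subst hR
    obtain ⟨a, ha, h0⟩ := h (Finset.mem_singleton_self _)
    exact ⟨⟨a, ha⟩, h0⟩
  | join φ ψ ihφ ihψ =>
    exact ⟨ihφ s fun h' => h (Finset.mem_union_left _ h'),
      ihψ s fun h' => h (Finset.mem_union_right _ h')⟩
  | proj B φ ih =>
    -- Projected attributes get the nonzero value 1, so a name that loses an attribute never needs
    -- the missing all-zero tuple.
    refine ⟨fun a => if (a : α) ∈ B then s a else 1, ih (fun a => if a ∈ B then s a else 1) ?_,
      fun a hB _ => by simp [hB]⟩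
    intro hR
    by_cases hRB : Q.attrs R ⊆ B
    · obtain ⟨a, ha, h0⟩ := h (Finset.mem_filter.2 ⟨hR, hRB⟩)
      exact ⟨a, ha, by simpa [hRB ha] using h0⟩
    · obtain ⟨a, ha, haB⟩ := Finset.not_subset.1 hRB
      exact ⟨a, ha, by simp [haB]⟩

/-- If `R` did not survive, the plan would return the all-zero tuple on the instance where `R` lacks
it, a wrong answer. -/
theorem IsPlanFor.survivors_eq_univ [Fintype ρ] {φ : JPPlan ρ α} (hφ : φ.IsPlanFor Q) :
    φ.survivors Q = Finset.univ := by
  refine Finset.eq_univ_of_forall fun R => ?_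
  by_contra hR
  obtain ⟨_, h, hD⟩ := hφ
  have h0 := (hD (punctured Q R) fun _ => 0).1
    (mem_eval_punctured φ (fun _ => 0) fun h => absurd h hR)
  obtain ⟨a, ha⟩ := h0 R rfl
  exact ha rfl

theorem mem_eval_joinPlan_iff {δ : Type*} (D : Q.Instance δ) (θ : JPPlan ρ α)
    (hθ : θ.IsJoinPlan) (s : α → δ) :
    (fun a => s a : DBTuple (θ.attrs Q) δ) ∈ θ.eval Q D ↔
      ∀ R ∈ θ.rels, (fun a => s a : DBTuple (Q.attrs R) δ) ∈ D R := by
  induction θ with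
  | rel R => simp [eval, rels]; rfl
  | join φ ψ ihφ ihψ =>
    rw [rels, Finset.forall_mem_union, ← ihφ hθ.1, ← ihψ hθ.2]
    rfl
  | proj B φ _ => exact hθ.elim

theorem IsJoinPlan.isPlanFor [Fintype ρ] {θ : JPPlan ρ α} (hθ : θ.IsJoinPlan)
    (hr : θ.rels = Finset.univ) : θ.IsPlanFor Q := by
  have hwf : ∀ θ : JPPlan ρ α, θ.IsJoinPlan → θ.WellFormed Q := by
    intro θ hθ
    induction θ with
    | rel R => trivial
    | join φ ψ ihφ ihψ => exact ⟨ihφ hθ.1, ihψ hθ.2⟩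
    | proj B φ _ => exact hθ.elim
  have hA : θ.attrs Q = Q.allAttrs := by rw [attrs_eq_attrsOf_rels θ hθ, hr]; rfl
  refine ⟨hwf θ hθ, hA, fun D t => ?_⟩
  have := mem_eval_joinPlan_iff D θ hθ (fun a => if h : a ∈ Q.allAttrs then t ⟨a, h⟩ else 0)
  convert this using 1
  · congr! 1
    funext a
    simp [hA.subset a.2]
  · rw [hr]
    simp only [Finset.mem_univ, true_imp_iff]
    refine forall_congr' fun R => ?_
    congr! 1
    funext a
    simp [Q.attrs_subset R a.2]

end Relations

theorem eval_mono [DecidableEq α] {Q : JoinQuery ρ α} {δ : Type*} {D D' : Q.Instance δ}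
    (h : ∀ R, D R ⊆ D' R) (φ : JPPlan ρ α) : φ.eval Q D ⊆ φ.eval Q D' := by
  induction φ with
  | rel R => exact h R
  | join φ ψ ihφ ihψ => exact fun t ht => ⟨ihφ ht.1, ihψ ht.2⟩
  | proj B φ ih => exact fun t ⟨s, hs, hst⟩ => ⟨s, ih hs, hst⟩

theorem WellFormed.attrs_subset [Fintype ρ] [DecidableEq α] {Q : JoinQuery ρ α} {φ : JPPlan ρ α}
    (h : φ.WellFormed Q) : φ.attrs Q ⊆ Q.allAttrs := by
  induction φ with
  | rel R => exact Q.attrs_subset R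
  | join φ ψ ihφ ihψ => exact Finset.union_subset (ihφ h.1) (ihψ h.2)
  | proj B φ ih => exact h.1.trans (ih h.2)

end JPPlan

/-! ### The random instance as a random set of atoms -/

namespace JoinQuery

variable {ρ α : Type*} {Q : JoinQuery ρ α} {N : ℕ}

/-- The atoms over the domain `Fin N`: a relation name together with a tuple. -/
abbrev Atom (Q : JoinQuery ρ α) (N : ℕ) := Σ R : ρ, DBTuple (Q.attrs R) (Fin N)

/-- The instance that consists of the atoms in `F`. -/
def ofAtoms (F : Finset (Q.Atom N)) : Q.Instance (Fin N) := fun R => {t | ⟨R, t⟩ ∈ F}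

theorem ofAtoms_mono {F G : Finset (Q.Atom N)} (h : F ⊆ G) (R : ρ) :
    ofAtoms F R ⊆ ofAtoms G R := fun _ ht => h ht

/-- The atoms that the assignment `s` requires for the relation names in `W`. -/
def atomsOf (Q : JoinQuery ρ α) (W : Finset ρ) (s : α → Fin N) : Finset (Q.Atom N) :=
  W.map ⟨fun R => ⟨R, fun a => s a⟩, Function.Injective.of_comp (f := Sigma.fst) fun _ _ h => h⟩

theorem mem_atomsOf {W : Finset ρ} {s : α → Fin N} {z : Q.Atom N} :
    z ∈ Q.atomsOf W s ↔ z.1 ∈ W ∧ (fun a => s a : DBTuple (Q.attrs z.1) (Fin N)) = z.2 := by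
  obtain ⟨R, t⟩ := z
  simp only [atomsOf, Finset.mem_map]
  constructor
  · rintro ⟨R', hR', h⟩
    cases h
    exact ⟨hR', rfl⟩
  · rintro ⟨hR, h⟩
    exact ⟨R, hR, congrArg (Sigma.mk R) h⟩

theorem atomsOf_mono {W W' : Finset ρ} (h : W ⊆ W') (s : α → Fin N) :
    Q.atomsOf W s ⊆ Q.atomsOf W' s := Finset.map_subset_map.2 h

theorem prod_atomsOf (p : ρ → ℝ) (W : Finset ρ) (s : α → Fin N) :
    ∏ z ∈ Q.atomsOf W s, p z.1 = ∏ R ∈ W, p R := by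
  rw [atomsOf, Finset.prod_map]
  rfl

section ExpectedSize

variable [Fintype ρ] [DecidableEq ρ] [DecidableEq α]

theorem sum_instanceProb (p : ρ → ℝ) (f : Q.Instance (Fin N) → ℝ)
    {_ : Fintype (Q.Instance (Fin N))} :
    ∑ D, Q.instanceProb N p D * f D =
      subsetExp (fun z : Q.Atom N => p z.1) fun F => f (ofAtoms F) := by
  classical
  refine Fintype.sum_equiv ⟨fun D => ({z | z.2 ∈ D z.1} : Finset (Q.Atom N)), ofAtoms, fun D => by
    funext R; ext t; simp [ofAtoms], fun F => by ext z; simp [ofAtoms]⟩ _ _ fun D => ?_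
  have hD : ofAtoms ({z | z.2 ∈ D z.1} : Finset (Q.Atom N)) = D := by
    funext R; ext t; simp [ofAtoms]
  simp only [Equiv.coe_fn_mk, hD]
  congr 1
  rw [instanceProb, subsetWeight, Fintype.prod_sigma]
  refine Finset.prod_congr rfl fun R _ => Finset.prod_congr (by ext; simp) fun t _ => ?_
  by_cases h : t ∈ D R <;> simp [h]

theorem expectedSize_eq (p : ρ → ℝ) (φ : JPPlan ρ α) :
    Q.expectedSize N p φ = ∑ t : DBTuple (φ.attrs Q) (Fin N),
      subsetProb (fun z : Q.Atom N => p z.1) fun F => t ∈ φ.eval Q (ofAtoms F) := by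
  classical
  rw [expectedSize, sum_instanceProb p fun D => ((φ.eval Q D).ncard : ℝ)]
  simp only [subsetProb]
  rw [← subsetExp_sum]
  congr 1
  funext F
  rw [Finset.sum_boole, Set.ncard_eq_toFinset_card']
  congr 2
  ext t
  simp

theorem expectedSize_nonneg {p : ρ → ℝ} (hp : ∀ R, p R ∈ Set.Ioo (0 : ℝ) 1) (φ : JPPlan ρ α) :
    0 ≤ Q.expectedSize N p φ := by
  rw [expectedSize_eq]
  have hq : ∀ z : Q.Atom N, p z.1 ∈ Set.Ioo (0 : ℝ) 1 := fun z => hp z.1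
  exact Finset.sum_nonneg fun t _ => subsetProb_nonneg hq _

theorem exists_extension (hN : 0 < N) {A : Finset α} (t : DBTuple A (Fin N)) :
    ∃ s : α → Fin N, (fun a : A => s a) = t :=
  ⟨fun a => if h : a ∈ A then t ⟨a, h⟩ else ⟨0, hN⟩, by funext a; simp⟩

/-- Distinct names require distinct, hence independent, atoms, so every tuple has the same
probability, and the size depends only on the set of names joined. -/
theorem expectedSize_joinPlan (hN : 0 < N) (p : ρ → ℝ) {θ : JPPlan ρ α} (hθ : θ.IsJoinPlan) :
    Q.expectedSize N p θ = Q.weight N p θ.rels (Q.attrsOf θ.rels) := by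
  rw [expectedSize_eq]
  have h : ∀ t : DBTuple (θ.attrs Q) (Fin N),
      subsetProb (fun z : Q.Atom N => p z.1) (fun F => t ∈ θ.eval Q (ofAtoms F)) =
        ∏ R ∈ θ.rels, p R := fun t => by
    obtain ⟨s, rfl⟩ := exists_extension hN t
    rw [← prod_atomsOf (Q := Q) p θ.rels s, ← subsetProb_subset]
    congr 1
    funext F
    rw [JPPlan.mem_eval_joinPlan_iff _ θ hθ]
    refine propext ⟨fun h z hz => ?_, fun h R hR => h (mem_atomsOf.2 ⟨hR, rfl⟩)⟩
    obtain ⟨hz1, hz2⟩ := mem_atomsOf.1 hz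
    have := h z.1 hz1
    rwa [hz2] at this
  rw [Finset.sum_congr rfl fun t _ => h t, Finset.sum_const, Finset.card_univ, weight,
    Finset.filter_true_of_mem fun R hR => attrs_subset_attrsOf hR,
    ← JPPlan.attrs_eq_attrsOf_rels θ hθ]
  simp

/-- Whenever the atoms required by the relation names in `W` are present, an assignment satisfies
`φ` with probability at least `c`. -/
def Likely (Q : JoinQuery ρ α) (N : ℕ) (p : ρ → ℝ) (W : Finset ρ) (φ : JPPlan ρ α)
    (c : ℝ) : Prop :=
  ∀ s : α → Fin N, c ≤ subsetProb (fun z : Q.Atom N => p z.1) fun F =>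
    (fun a => s a : DBTuple (φ.attrs Q) (Fin N)) ∈ φ.eval Q (ofAtoms (F ∪ Q.atomsOf W s))

theorem likely_rel (p : ρ → ℝ) (R : ρ) : Q.Likely N p {R} (.rel R) 1 := fun _ =>
  (subsetProb_of_forall fun _ => Finset.mem_union_right _
    (mem_atomsOf.2 ⟨Finset.mem_singleton_self R, rfl⟩)).ge

/-- Plans are monotone in the instance, so with planted atoms both acceptance events are increasing
and Harris' inequality applies. -/
theorem Likely.join {p : ρ → ℝ} (hp : ∀ R, p R ∈ Set.Ioo (0 : ℝ) 1) {W₁ W₂ : Finset ρ}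
    {φ ψ : JPPlan ρ α} {c₁ c₂ : ℝ} (hc₂ : 0 ≤ c₂)
    (h₁ : Q.Likely N p W₁ φ c₁) (h₂ : Q.Likely N p W₂ ψ c₂) :
    Q.Likely N p (W₁ ∪ W₂) (.join φ ψ) (c₁ * c₂) := by
  intro s
  have hq : ∀ z : Q.Atom N, p z.1 ∈ Set.Ioo (0 : ℝ) 1 := fun z => hp z.1
  have hm : ∀ (χ : JPPlan ρ α) (Z : Finset (Q.Atom N)) (t : DBTuple (χ.attrs Q) (Fin N)),
      Monotone fun F : Finset (Q.Atom N) => t ∈ χ.eval Q (ofAtoms (F ∪ Z)) :=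
    fun χ Z t F G hFG ht =>
      JPPlan.eval_mono (ofAtoms_mono (Finset.union_subset_union_left hFG)) χ ht
  refine (mul_le_mul (h₁ s) (h₂ s) hc₂ (subsetProb_nonneg hq _)).trans
    ((subsetProb_mul_le hq (hm φ _ _) (hm ψ _ _)).trans
      (subsetProb_mono hq fun F hF => ⟨?_, ?_⟩))
  · exact JPPlan.eval_mono (ofAtoms_mono (Finset.union_subset_union_right
      (atomsOf_mono Finset.subset_union_left s))) φ hF.1
  · exact JPPlan.eval_mono (ofAtoms_mono (Finset.union_subset_union_right
      (atomsOf_mono Finset.subset_union_right s))) ψ hF.2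

end ExpectedSize

end JoinQuery

/-! ### Second moment bound for extending an assignment -/

namespace JoinQuery

variable {ρ α : Type*} {Q : JoinQuery ρ α} {N : ℕ} {p : ρ → ℝ}
  [Fintype ρ] [DecidableEq ρ] [DecidableEq α]

/-- Two assignments that agree on `C` are jointly, up to their further agreement, not much more likely than two independent ones. -/
theorem prod_atomsOf_union_le (hN : 0 < N) (hp : ∀ R, p R ∈ Set.Ioo (0 : ℝ) 1) {W : Finset ρ}
    {C : Finset α} {r : ℝ} (hr : 0 < r)
    (hC : ∀ C', C ⊆ C' → r * Q.weight N p W C ≤ Q.weight N p W C')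
    {s s' : α → Fin N} (hs : ∀ a ∈ C, s a = s' a) :
    ∏ z ∈ Q.atomsOf {R ∈ W | ¬ Q.attrs R ⊆ C} s ∪ Q.atomsOf {R ∈ W | ¬ Q.attrs R ⊆ C} s', p z.1 ≤
      (∏ R ∈ W with ¬ Q.attrs R ⊆ C, p R) ^ 2 / r *
        (N : ℝ) ^ ({a ∈ Q.allAttrs \ C | s a = s' a} : Finset α).card := by
  set W' : Finset ρ := {R ∈ W | ¬ Q.attrs R ⊆ C} with hW'
  set D : Finset α := {a ∈ Q.allAttrs \ C | s a = s' a} with hD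
  -- An atom is shared exactly when `s` and `s'` agree on all attributes of its name, that is, on a
  -- subset of `C ∪ D`.
  have hinter : Q.atomsOf W' s ∩ Q.atomsOf W' s' = Q.atomsOf {R ∈ W' | Q.attrs R ⊆ C ∪ D} s := by
    ext ⟨R, t⟩
    simp only [Finset.mem_inter, mem_atomsOf, Finset.mem_filter]
    constructor
    · rintro ⟨⟨hR, rfl⟩, _, h⟩
      refine ⟨⟨hR, fun a ha => ?_⟩, rfl⟩
      have ha' := congrFun h ⟨a, ha⟩
      by_cases haC : a ∈ C
      · exact Finset.mem_union_left _ haC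
      · exact Finset.mem_union_right _ (Finset.mem_filter.2
          ⟨Finset.mem_sdiff.2 ⟨Q.attrs_subset R ha, haC⟩, ha'.symm⟩)
    · rintro ⟨⟨hR, hsub⟩, rfl⟩
      refine ⟨⟨hR, rfl⟩, hR, ?_⟩
      funext ⟨a, ha⟩
      rcases Finset.mem_union.1 (hsub ha) with h | h
      · exact (hs a h).symm
      · exact (Finset.mem_filter.1 h).2.symm
  have hprod := Finset.prod_union_inter (s₁ := Q.atomsOf W' s) (s₂ := Q.atomsOf W' s')
    (f := fun z => p z.1)
  rw [hinter, prod_atomsOf, prod_atomsOf, prod_atomsOf] at hprod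
  have hσ : 0 < ∏ R ∈ W' with Q.attrs R ⊆ C ∪ D, p R := Finset.prod_pos fun R _ => (hp R).1
  have hsplit : ∏ R ∈ W with Q.attrs R ⊆ C ∪ D, p R =
      (∏ R ∈ W with Q.attrs R ⊆ C, p R) * ∏ R ∈ W' with Q.attrs R ⊆ C ∪ D, p R := by
    rw [← Finset.prod_filter_mul_prod_filter_not {R ∈ W | Q.attrs R ⊆ C ∪ D}
      (fun R => Q.attrs R ⊆ C), Finset.filter_filter, Finset.filter_filter, hW',
      Finset.filter_filter]
    congr 1
    · exact Finset.prod_congr (Finset.filter_congr fun R _ =>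
        ⟨fun h => h.2, fun h => ⟨h.trans Finset.subset_union_left, h⟩⟩) fun _ _ => rfl
    · exact Finset.prod_congr (Finset.filter_congr fun R _ => and_comm) fun _ _ => rfl
  have hdisj : Disjoint C D := Finset.disjoint_left.2 fun a ha h =>
    (Finset.mem_sdiff.1 (Finset.mem_filter.1 h).1).2 ha
  -- The hypothesis at `C ∪ D` bounds the correlation gained from shared atoms by `N ^ |D| / r`.
  have hrσ : r ≤ (N : ℝ) ^ D.card * ∏ R ∈ W' with Q.attrs R ⊆ C ∪ D, p R := by
    have h := hC (C ∪ D) Finset.subset_union_left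
    refine le_of_mul_le_mul_right (h.trans_eq ?_) (weight_pos (Q := Q) hN hp W C)
    rw [weight, weight, hsplit, Finset.card_union_of_disjoint hdisj, pow_add]
    ring
  rw [div_mul_eq_mul_div, le_div_iff₀ hr, sq, ← hprod, mul_assoc]
  refine mul_le_mul_of_nonneg_left ?_ (Finset.prod_nonneg fun z _ => (hp z.1).1.le)
  rwa [mul_comm (∏ R ∈ W' with Q.attrs R ⊆ C ∪ D, p R)]

/-- The number of pairs of functions, weighted by their agreement. -/
theorem sum_prod_agree_le {κ : Type*} [Fintype κ] [DecidableEq κ] (u : κ → Fin N) :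
    ∑ u' : κ → Fin N, ∏ v, (if u v = u' v then (N : ℝ) else 1) ≤
      (2 * N : ℝ) ^ Fintype.card κ := by
  have h := Finset.prod_univ_sum (fun _ : κ => (Finset.univ : Finset (Fin N)))
    (fun v b => if u v = b then (N : ℝ) else 1)
  rw [Fintype.piFinset_univ] at h
  rw [← h, ← Finset.card_univ]
  rw [← Finset.prod_const]
  refine Finset.prod_le_prod (fun v _ => Finset.sum_nonneg fun b _ => ?_) fun v _ => ?_
  · split_ifs <;> positivity
  -- Agreement has weight `N` but only one value, so it adds no more than the `N` values together:
  -- this is the factor 2 per attribute.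
  · calc ∑ b, (if u v = b then (N : ℝ) else 1) ≤ ∑ b, ((if u v = b then (N : ℝ) else 0) + 1) :=
          Finset.sum_le_sum fun b _ => by split_ifs <;> simp
      _ = 2 * N := by simp [Finset.sum_add_distrib, two_mul]

/-- Second moment method for the number `Y` of extensions of `s` beyond `C` whose atoms for names
outside `C` are present and which `φ` accepts. Projections use it with `r = 1`, the size bound with
the ratio given by tightness. -/
theorem Likely.extend (hN : 0 < N) (hp : ∀ R, p R ∈ Set.Ioo (0 : ℝ) 1) {W : Finset ρ}
    {φ : JPPlan ρ α} {c : ℝ} (hc : 0 < c) (hφ : Q.Likely N p W φ c) {C : Finset α} {r : ℝ}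
    (hr : 0 < r) (hC : ∀ C', C ⊆ C' → r * Q.weight N p W C ≤ Q.weight N p W C')
    (s : α → Fin N) :
    c ^ 2 * r / 2 ^ Q.allAttrs.card ≤ subsetProb (fun z : Q.Atom N => p z.1) fun F =>
      ∃ s' : α → Fin N, (∀ a ∈ C, s' a = s a) ∧
        (fun a => s' a : DBTuple (φ.attrs Q) (Fin N)) ∈
          φ.eval Q (ofAtoms (F ∪ Q.atomsOf {R ∈ W | Q.attrs R ⊆ C} s)) := by
  classical
  have hq : ∀ z : Q.Atom N, p z.1 ∈ Set.Ioo (0 : ℝ) 1 := fun z => hp z.1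
  set q : Q.Atom N → ℝ := fun z => p z.1 with hqdef
  set V := Q.allAttrs \ C with hV
  set W' : Finset ρ := {R ∈ W | ¬ Q.attrs R ⊆ C} with hW'
  let e : (V → Fin N) → α → Fin N := fun u a => if h : a ∈ V then u ⟨a, h⟩ else s a
  have heC : ∀ u, ∀ a ∈ C, e u a = s a := fun u a ha =>
    dif_neg fun h => (Finset.mem_sdiff.1 h).2 ha
  have heV : ∀ u (v : V), e u v = u v := fun u v => dif_pos v.2
  let G : (V → Fin N) → Finset (Q.Atom N) → Prop := fun u F =>
    (fun a => e u a : DBTuple (φ.attrs Q) (Fin N)) ∈ φ.eval Q (ofAtoms (F ∪ Q.atomsOf W (e u)))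
  let Y : Finset (Q.Atom N) → ℝ := fun F =>
    ∑ u, if Q.atomsOf W' (e u) ⊆ F ∧ G u F then 1 else 0
  set π := ∏ R ∈ W', p R with hπ
  have hπ0 : 0 < π := Finset.prod_pos fun R _ => (hp R).1
  have hM : (0 : ℝ) < (N : ℝ) ^ V.card := pow_pos (by exact_mod_cast hN) _
  have h1 : (N : ℝ) ^ V.card * (π * c) ≤ subsetExp q Y := by
    -- Requiring the atoms of `W'` costs `π`; planting them changes nothing in `G`, which already
    -- plants all of `W`.
    have : ∀ u, π * c ≤ subsetProb q (fun F => Q.atomsOf W' (e u) ⊆ F ∧ G u F) := fun u => by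
      rw [subsetProb_union, hqdef, prod_atomsOf]
      refine mul_le_mul_of_nonneg_left ((hφ (e u)).trans_eq ?_) hπ0.le
      congr 1
      funext F
      dsimp only [G]
      rw [Finset.union_assoc, Finset.union_eq_right.2 (atomsOf_mono (Finset.filter_subset _ _) _)]
    calc (N : ℝ) ^ V.card * (π * c) = ∑ u : V → Fin N, π * c := by simp
      _ ≤ ∑ u : V → Fin N, subsetProb q (fun F => Q.atomsOf W' (e u) ⊆ F ∧ G u F) :=
        Finset.sum_le_sum fun u _ => this u
      _ = _ := by
        simp only [Y, subsetProb]
        rw [subsetExp_sum]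
        refine Finset.sum_congr rfl fun u _ => ?_
        congr! 3
  have h2 : subsetExp q (fun F => Y F ^ 2) ≤
      π ^ 2 / r * ((N : ℝ) ^ V.card) ^ 2 * 2 ^ V.card := by
    -- For the upper bound acceptance by `φ` is dropped and only the presence of atoms is kept.
    calc _ ≤ subsetExp q (fun F => ∑ u, ∑ u',
          if Q.atomsOf W' (e u) ∪ Q.atomsOf W' (e u') ⊆ F then (1 : ℝ) else 0) := by
          refine subsetExp_mono hq fun F => ?_
          rw [sq, Finset.sum_mul_sum]
          refine Finset.sum_le_sum fun u _ => Finset.sum_le_sum fun u' _ => ?_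
          by_cases h : Q.atomsOf W' (e u) ⊆ F <;> by_cases h' : Q.atomsOf W' (e u') ⊆ F <;>
            simp only [h, h', Finset.union_subset_iff, true_and, false_and, if_false, if_true,
              mul_zero, zero_mul, le_refl, and_self, and_false]
          split_ifs <;> norm_num
      _ = ∑ u, ∑ u', ∏ z ∈ Q.atomsOf W' (e u) ∪ Q.atomsOf W' (e u'), q z := by
          rw [subsetExp_sum]
          refine Finset.sum_congr rfl fun u _ => ?_
          rw [subsetExp_sum]
          refine Finset.sum_congr rfl fun u' _ => ?_
          rw [← subsetProb_subset, subsetProb]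
          congr! 3
      _ ≤ ∑ u : V → Fin N, ∑ u' : V → Fin N,
            π ^ 2 / r * ∏ v, (if u v = u' v then (N : ℝ) else 1) := by
          refine Finset.sum_le_sum fun u _ => Finset.sum_le_sum fun u' _ => ?_
          refine (prod_atomsOf_union_le hN hp hr hC
            (fun a ha => (heC u a ha).trans (heC u' a ha).symm)).trans_eq ?_
          congr 1
          rw [← Finset.prod_const, Finset.prod_filter, ← Finset.prod_coe_sort]
          exact Finset.prod_congr rfl fun v _ => by rw [heV, heV]
      _ ≤ ∑ u : V → Fin N, π ^ 2 / r * (2 * N : ℝ) ^ V.card := by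
          refine Finset.sum_le_sum fun u _ => ?_
          rw [← Finset.mul_sum]
          refine mul_le_mul_of_nonneg_left ?_ (by positivity)
          simpa using sum_prod_agree_le u
      _ = _ := by
          simp [mul_pow]
          ring
  have h3 : subsetProb q (fun F => Y F ≠ 0) ≤ subsetProb q fun F =>
      ∃ s' : α → Fin N, (∀ a ∈ C, s' a = s a) ∧
        (fun a => s' a : DBTuple (φ.attrs Q) (Fin N)) ∈
          φ.eval Q (ofAtoms (F ∪ Q.atomsOf {R ∈ W | Q.attrs R ⊆ C} s)) := by
    refine subsetProb_mono hq fun F hF => ?_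
    obtain ⟨u, _, hu⟩ := Finset.exists_ne_zero_of_sum_ne_zero hF
    have hu' : Q.atomsOf W' (e u) ⊆ F ∧ G u F := by
      by_contra h
      exact hu (if_neg h)
    refine ⟨e u, heC u, JPPlan.eval_mono (ofAtoms_mono ?_) φ hu'.2⟩
    refine Finset.union_subset Finset.subset_union_left fun z hz => ?_
    obtain ⟨hz1, hz2⟩ := mem_atomsOf.1 hz
    by_cases h : Q.attrs z.1 ⊆ C
    · refine Finset.mem_union_right _ (mem_atomsOf.2 ⟨Finset.mem_filter.2 ⟨hz1, h⟩, ?_⟩)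
      rw [← hz2]
      funext a
      exact (heC u a (h a.2)).symm
    · exact Finset.mem_union_left _
        (hu'.1 (mem_atomsOf.2 ⟨Finset.mem_filter.2 ⟨hz1, h⟩, hz2⟩))
  refine le_trans ?_ h3
  have hP := subsetProb_nonneg hq (fun F => Y F ≠ 0)
  have h4 : ((N : ℝ) ^ V.card * (π * c)) ^ 2 ≤
      π ^ 2 / r * ((N : ℝ) ^ V.card) ^ 2 * 2 ^ V.card * subsetProb q (fun F => Y F ≠ 0) :=
    (pow_le_pow_left₀ (by positivity) h1 2).trans
      ((subsetExp_sq_le hq Y).trans (mul_le_mul_of_nonneg_right h2 hP))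
  have h5 : c ^ 2 * r ≤ subsetProb q (fun F => Y F ≠ 0) * 2 ^ V.card := by
    have hpos : 0 < π ^ 2 / r * ((N : ℝ) ^ V.card) ^ 2 := by positivity
    refine le_of_mul_le_mul_left (le_trans (le_of_eq ?_) (h4.trans_eq ?_)) hpos
    · field_simp
    · ring
  rw [div_le_iff₀ (by positivity)]
  refine h5.trans (mul_le_mul_of_nonneg_left ?_ hP)
  exact pow_le_pow_right₀ one_le_two (Finset.card_le_card Finset.sdiff_subset)

end JoinQuery

/-! ### Lower bound for the expected size of a subplan -/

namespace JoinQuery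

variable {ρ α : Type*} {Q : JoinQuery ρ α} {N : ℕ} {p : ρ → ℝ}
  [Fintype ρ] [DecidableEq ρ] [DecidableEq α]

/-- For a tuple over the attributes of `φ`, the names of `W` inside these attributes are paid for by
their probabilities; the others are supplied by `Likely.extend` with `C` the attributes of `φ`.
Summing over all tuples recovers the tight weight. -/
theorem weight_le_expectedSize (hN : 0 < N) (hp : ∀ R, p R ∈ Set.Ioo (0 : ℝ) 1) {W : Finset ρ}
    {φ : JPPlan ρ α} {c : ℝ} (hc : 0 < c) (hφ : Q.Likely N p W φ c)
    (hW : Q.Tight N p W (φ.attrs Q)) :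
    Q.weight N p W (Q.attrsOf W) ≤ 2 ^ Q.allAttrs.card / c ^ 2 * Q.expectedSize N p φ := by
  have hq : ∀ z : Q.Atom N, p z.1 ∈ Set.Ioo (0 : ℝ) 1 := fun z => hp z.1
  set A := φ.attrs Q with hA
  have h0 := weight_pos (Q := Q) hN hp W A
  set r := Q.weight N p W (A ∪ Q.attrsOf W) / Q.weight N p W A with hr
  have hr0 : 0 < r := div_pos (weight_pos hN hp W _) h0
  have hrW : r * Q.weight N p W A = Q.weight N p W (A ∪ Q.attrsOf W) := div_mul_cancel₀ _ h0.ne'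
  have hext := hφ.extend hN hp hc hr0 (C := A) fun C' hC' => hrW.trans_le (hW C' hC')
  have ht : ∀ t : DBTuple A (Fin N),
      (∏ R ∈ W with Q.attrs R ⊆ A, p R) * (c ^ 2 * r / 2 ^ Q.allAttrs.card) ≤
        subsetProb (fun z : Q.Atom N => p z.1) fun F => t ∈ φ.eval Q (ofAtoms F) := by
    intro t
    obtain ⟨s, rfl⟩ := exists_extension hN t
    have hs : c ^ 2 * r / 2 ^ Q.allAttrs.card ≤ subsetProb (fun z : Q.Atom N => p z.1) fun F =>
        (fun a => s a : DBTuple A (Fin N)) ∈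
          φ.eval Q (ofAtoms (F ∪ Q.atomsOf {R ∈ W | Q.attrs R ⊆ A} s)) := by
      refine (hext s).trans (subsetProb_mono hq fun F => ?_)
      rintro ⟨s', hs', hF⟩
      have : (fun a => s' a : DBTuple A (Fin N)) = fun a : A => s a := funext fun a => hs' a a.2
      rwa [← this]
    calc _ ≤ _ := mul_le_mul_of_nonneg_left hs (Finset.prod_nonneg fun R _ => (hp R).1.le)
      _ = subsetProb (fun z : Q.Atom N => p z.1) (fun F =>
            Q.atomsOf {R ∈ W | Q.attrs R ⊆ A} s ⊆ F ∧
              (fun a => s a : DBTuple A (Fin N)) ∈ φ.eval Q (ofAtoms F)) := by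
          rw [subsetProb_union, prod_atomsOf]
      _ ≤ _ := subsetProb_mono hq fun F hF => hF.2
  have hsum : Q.weight N p W A * (c ^ 2 * r / 2 ^ Q.allAttrs.card) ≤ Q.expectedSize N p φ := by
    rw [expectedSize_eq]
    refine le_trans (le_of_eq ?_) (Finset.sum_le_sum fun t _ => ht t)
    simp [weight]
    ring
  have hle : Q.weight N p W (Q.attrsOf W) ≤ Q.weight N p W (A ∪ Q.attrsOf W) :=
    weight_le_of_filter_eq hN hp Finset.subset_union_right (Finset.filter_congr fun R hR =>
      ⟨fun h => h.trans Finset.subset_union_right, fun _ => attrs_subset_attrsOf hR⟩)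
  rw [div_mul_eq_mul_div, le_div_iff₀ (by positivity)]
  calc _ ≤ Q.weight N p W (A ∪ Q.attrsOf W) * c ^ 2 :=
        mul_le_mul_of_nonneg_right hle (sq_nonneg c)
    _ = 2 ^ Q.allAttrs.card * (Q.weight N p W A * (c ^ 2 * r / 2 ^ Q.allAttrs.card)) := by
        rw [← hrW]; field_simp
    _ ≤ _ := mul_le_mul_of_nonneg_left hsum (by positivity)

end JoinQuery

/-! ### Construction of the join plan -/

namespace JPPlan

variable {ρ α : Type*}

/-- A lower bound for the probability that an assignment satisfies a plan, if the atoms required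
by a suitable set of relation names are present; `k` bounds the number of attributes. -/
noncomputable def likelihood (k : ℕ) : JPPlan ρ α → ℝ
  | rel _ => 1
  | join φ ψ => φ.likelihood k * ψ.likelihood k
  | proj _ φ => φ.likelihood k ^ 2 / 2 ^ k

theorem likelihood_mem (k : ℕ) (φ : JPPlan ρ α) : φ.likelihood k ∈ Set.Ioc (0 : ℝ) 1 := by
  induction φ with
  | rel R => simp [likelihood]
  | join φ ψ ihφ ihψ => exact ⟨mul_pos ihφ.1 ihψ.1, mul_le_one₀ ihφ.2 ihψ.1.le ihψ.2⟩
  | proj B φ ih =>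
    exact ⟨div_pos (pow_pos ih.1 2) (by positivity), div_le_one_of_le₀
      ((pow_le_one₀ ih.1.le ih.2).trans (one_le_pow₀ one_le_two)) (by positivity)⟩

theorem likelihood_proj_le (k : ℕ) (B : Finset α) (φ : JPPlan ρ α) :
    (proj B φ).likelihood k ≤ φ.likelihood k := by
  have h := φ.likelihood_mem k
  refine (div_le_self (sq_nonneg _) (one_le_pow₀ one_le_two)).trans ?_
  exact pow_le_of_le_one h.1.le h.2 two_ne_zero

variable [Fintype ρ] [DecidableEq ρ] [DecidableEq α] {Q : JoinQuery ρ α} {N : ℕ} {p : ρ → ℝ}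

open JoinQuery in
/-- The relation names to be joined in place of a join-project plan `φ`, and the join plan for
them. -/
theorem exists_joinPlan (hN : 0 < N) (hp : ∀ R, p R ∈ Set.Ioo (0 : ℝ) 1) {T : ℝ}
    (φ : JPPlan ρ α) (hφ : φ.WellFormed Q) (hT : ∀ ψ ∈ φ.subplans, Q.expectedSize N p ψ ≤ T) :
    ∃ W : Finset ρ, φ.survivors Q ⊆ W ∧ Q.Tight N p W (φ.attrs Q) ∧
      Q.Likely N p W φ (φ.likelihood Q.allAttrs.card) ∧
      (W = ∅ ∨ ∃ θ : JPPlan ρ α, θ.IsJoinPlan ∧ θ.rels = W ∧ ∀ ξ ∈ θ.subplans,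
        Q.weight N p ξ.rels (Q.attrsOf ξ.rels) ≤
          2 ^ Q.allAttrs.card / φ.likelihood Q.allAttrs.card ^ 2 * T) := by
  have hT0 : 0 ≤ T := (expectedSize_nonneg hp φ).trans (hT φ φ.mem_subplans_self)
  set k := Q.allAttrs.card with hk
  have hmono : ∀ {c c' x : ℝ}, 0 < c' → c' ≤ c → x ≤ 2 ^ k / c ^ 2 * T →
      x ≤ 2 ^ k / c' ^ 2 * T := fun h0 h hx => hx.trans (by gcongr)
  induction φ with
  | rel R =>
    have ht := tight_singleton (Q := Q) hN hp R
    have hl := likely_rel (Q := Q) (N := N) p R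
    refine ⟨{R}, subset_rfl, ht, hl, Or.inr ⟨rel R, trivial, rfl, fun ξ hξ => ?_⟩⟩
    rw [Set.mem_singleton_iff.1 hξ]
    exact (weight_le_expectedSize hN hp one_pos hl ht).trans
      (mul_le_mul_of_nonneg_left (hT _ rfl) (by positivity))
  | join φ ψ ihφ ihψ =>
    obtain ⟨W₁, hs₁, ht₁, hl₁, h₁⟩ := ihφ hφ.1 fun ξ hξ => hT ξ (Or.inr (Or.inl hξ))
    obtain ⟨W₂, hs₂, ht₂, hl₂, h₂⟩ := ihψ hφ.2 fun ξ hξ => hT ξ (Or.inr (Or.inr hξ))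
    have hm₁ := φ.likelihood_mem k
    have hm₂ := ψ.likelihood_mem k
    have hm := (join φ ψ).likelihood_mem k
    have hle₁ : (join φ ψ).likelihood k ≤ φ.likelihood k := mul_le_of_le_one_right hm₁.1.le hm₂.2
    have hle₂ : (join φ ψ).likelihood k ≤ ψ.likelihood k := mul_le_of_le_one_left hm₂.1.le hm₁.2
    have ht := ht₁.union hN hp ht₂
    have hl := hl₁.join hp hm₂.1.le hl₂
    refine ⟨W₁ ∪ W₂, Finset.union_subset_union hs₁ hs₂, ht, hl, ?_⟩
    -- Projections may discard every name of a subplan, and no plan is an empty join; such a side is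
    -- simply omitted.
    rcases h₁ with rfl | ⟨θ₁, hj₁, rfl, hb₁⟩ <;> rcases h₂ with rfl | ⟨θ₂, hj₂, rfl, hb₂⟩
    · exact Or.inl (Finset.union_empty _)
    · exact Or.inr ⟨θ₂, hj₂, (Finset.empty_union _).symm, fun ξ hξ => hmono hm.1 hle₂ (hb₂ ξ hξ)⟩
    · exact Or.inr ⟨θ₁, hj₁, (Finset.union_empty _).symm, fun ξ hξ => hmono hm.1 hle₁ (hb₁ ξ hξ)⟩
    · refine Or.inr ⟨join θ₁ θ₂, ⟨hj₁, hj₂⟩, rfl, fun ξ hξ => ?_⟩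
      rcases hξ with h | h | h
      · rw [Set.mem_singleton_iff.1 h]
        exact (weight_le_expectedSize hN hp hm.1 hl ht).trans
          (mul_le_mul_of_nonneg_left (hT _ (Or.inl rfl)) (by positivity))
      · exact hmono hm.1 hle₁ (hb₁ ξ h)
      · exact hmono hm.1 hle₂ (hb₂ ξ h)
  | proj B φ ih =>
    obtain ⟨W, hs, ht, hl, h⟩ := ih hφ.2 fun ξ hξ => hT ξ (Or.inr hξ)
    obtain ⟨C, hBC, hmin⟩ := exists_weight_minimizer (Q := Q) hN hp W B
    have hm := (proj B φ).likelihood_mem k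
    refine ⟨{R ∈ W | Q.attrs R ⊆ C}, ?_, tight_of_minimizer hN hp hBC hmin, ?_, ?_⟩
    · intro R hR
      obtain ⟨hR, hRB⟩ := Finset.mem_filter.1 hR
      exact Finset.mem_filter.2 ⟨hs hR, hRB.trans hBC⟩
    · intro s
      -- `C` is lightest among all supersets of `B`, hence among its own supersets, so `r = 1` is
      -- admissible.
      have hext := hl.extend hN hp (φ.likelihood_mem k).1 one_pos (C := C)
        (fun C' hC' => by rw [one_mul]; exact hmin C' (hBC.trans hC')) s
      rw [mul_one] at hext
      have hq : ∀ z : Q.Atom N, p z.1 ∈ Set.Ioo (0 : ℝ) 1 := fun z => hp z.1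
      refine hext.trans (subsetProb_mono hq fun F => ?_)
      rintro ⟨s', hs', hF⟩
      exact ⟨_, hF, fun a ha _ => (hs' a (hBC ha)).symm⟩
    · rcases h with rfl | ⟨θ, hj, rfl, hb⟩
      · exact Or.inl (Finset.filter_empty _)
      · rcases exists_restrict (fun R => Q.attrs R ⊆ C) θ hj with h | ⟨θ', hj', hr', hs'⟩
        · exact Or.inl h
        · refine Or.inr ⟨θ', hj', hr', fun ξ' hξ' => ?_⟩
          obtain ⟨ξ, hξ, h⟩ := hs' ξ' hξ'
          rw [h]
          -- Each join in the pruned plan is no larger in expectation than the join it came from.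
          exact (weight_filter_le hN hp (rels_subset_of_mem_subplans hξ) hBC hmin).trans
            (hmono hm.1 (likelihood_proj_le k B φ) (hb ξ hξ))

end JPPlan

theorem mainTheorem1 {ρ α : Type*} [Fintype ρ] [DecidableEq α]
    (Q : JoinQuery ρ α) (φ : JPPlan ρ α) (hφ : φ.IsPlanFor Q) :
    ∃ c : ℝ, ∀ p : ρ → ℕ → ℝ, (∀ R N, p R N ∈ Set.Ioo (0 : ℝ) 1) →
      ∀ᶠ N : ℕ in Filter.atTop, ∀ T : ℝ,
        (∀ ψ ∈ φ.subplans, Q.expectedSize N (fun R => p R N) ψ ≤ T) →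
        ∃ φ' : JPPlan ρ α, φ'.IsJoinPlan ∧ φ'.IsPlanFor Q ∧
          ∀ ψ ∈ φ'.subplans, Q.expectedSize N (fun R => p R N) ψ ≤ c * T := by
  classical
  refine ⟨2 ^ Q.allAttrs.card / φ.likelihood Q.allAttrs.card ^ 2, fun p hp => ?_⟩
  -- A nonempty domain is all that "sufficiently large" has to provide.
  filter_upwards [Filter.eventually_gt_atTop 0] with N hN T hT
  obtain ⟨W, hs, -, -, hW⟩ := JPPlan.exists_joinPlan hN (fun R => hp R N) φ hφ.1 hT
  rw [hφ.survivors_eq_univ] at hs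
  rcases hW with rfl | ⟨θ, hθ, rfl, hb⟩
  · obtain ⟨R, -⟩ := φ.rels_nonempty
    exact absurd (hs (Finset.mem_univ R)) (Finset.notMem_empty R)
  · refine ⟨θ, hθ, hθ.isPlanFor (Finset.univ_subset_iff.1 hs), fun ξ hξ => ?_⟩
    rw [JoinQuery.expectedSize_joinPlan hN _ (hθ.of_mem_subplans hξ)]
    exact hb ξ hξ
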